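/- Let $\omega=e^{\pi i/4}$, and let Riemann's auxiliary function be \[ \mathcal R(s)=\int_{0\swarrow1}\frac{x^{-s}e^{\pi i x^2}}{e^{\pi i x}-e^{-\pi i x}}\,dx , \] where $x^{-s}$ has its principal value and the path $0\swarrow1$ is any straight line of slope $1$ crossing the real axis at a point $c$ with $0<c<1$, traversed from upper right to lower left (that is, $x=c-\omega t$ with $t$ running from $-\infty$ to $+\infty$). Then for every $s\in\mathbb C$ with $\operatorname{Re}s<0$ and every choice of $c\in(0,1)$, the integral defining $\mathcal R(s)$ and the two integrals below converge absolutely, and \[ \mathcal R(s)=-\omega e^{-\pi i s/4}\bigl(1-e^{\pi i s}\bigr)\int_0^\infty y^{-s}\,\frac{e^{-\pi y^2+\pi\overline\omega y}}{1-e^{2\pi\overline\omega y}}\,dy , \] and, equivalently, \[ \mathcal R(s)=\omega e^{\pi i s/4}\sin\frac{\pi s}{2}\int_0^\infty \frac{y^{-s}e^{-\pi y^2}}{\sin(\pi\omega y)}\,dy . \] -/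

import Mathlib

/-- The eighth root of unity `ω = e^{πi/4}`. -/
noncomputable def omega : ℂ := Complex.exp (Real.pi * Complex.I / 4)

/-- The integrand `x^{-s} e^{πix²} / (e^{πix} - e^{-πix})` of Riemann's auxiliary function
(principal branch of `x^{-s}`, i.e. `|arg x| < π` off the negative real axis). -/
noncomputable def auxIntegrand (s x : ℂ) : ℂ :=
  x ^ (-s) * Complex.exp (Real.pi * Complex.I * x ^ 2) /
    (Complex.exp (Real.pi * Complex.I * x) - Complex.exp (-(Real.pi * Complex.I * x)))

/-- The path `0 ↙ 1`: the straight line of slope `1` that crosses the real axis at the point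
`c` (with `0 < c < 1`), run through from the upper right to the lower left. -/
noncomputable def auxPath (c t : ℝ) : ℂ := c - omega * t

/-- Riemann's auxiliary function
`R(s) = ∫_{0↙1} x^{-s} e^{πix²} / (e^{πix} - e^{-πix}) dx`, where the path of integration is the
line `auxPath c`, whose velocity is `-ω`. Any `c` in `(0, 1)` is admitted by the notation `0 ↙ 1`. -/
noncomputable def riemannAux (c : ℝ) (s : ℂ) : ℂ :=
  ∫ t : ℝ, auxIntegrand s (auxPath c t) * (-omega)

/-! Put x = ω(t + iv). Lines of slope 1 become horizontal, e^{πix²} becomes the Gaussian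
e^{-π(t+iv)²}, and the path crossing at c has height v = -c/√2. The strip 0 ≤ Re x - Im x ≤ c < 1
contains no zero of sin(πx) except 0 and misses the branch cut, so Cauchy's theorem moves the line
freely among heights v < 0 (`integral_auxIntegrand_shift`).

At the origin the integrand is O(|x|^{-Re s - 1}), integrable along the line because Re s < 0. The
lower bound |sin πx| ≥ (1-c)/2·|x| in the strip makes this uniform in v, and dominated convergence
gives v → 0 (`integral_auxIntegrand_shift_zero`).

The line through 0 splits into x = ωy and x = -ωy, with principal arguments π/4 and -3π/4. Both
halves carry the same integral over y > 0, with factors e^{-πis/4} and -e^{3πis/4}; their sum yields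
both closed forms. -/

theorem omega_eq : omega = ⟨√2 / 2, √2 / 2⟩ := by
  have h : omega = Complex.exp ((Real.pi / 4 : ℝ) * Complex.I) := by
    rw [omega]; push_cast; ring_nf
  rw [h]
  apply Complex.ext
  · rw [Complex.exp_ofReal_mul_I_re, Real.cos_pi_div_four]
  · rw [Complex.exp_ofReal_mul_I_im, Real.sin_pi_div_four]

theorem omega_sq : omega ^ 2 = Complex.I := by
  have h2 : √2 * √2 = 2 := Real.mul_self_sqrt (by norm_num)
  rw [omega_eq, pow_two]
  apply Complex.ext
  · simp
  · simp; linarith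

theorem norm_omega : ‖omega‖ = 1 := by
  have h : omega = Complex.exp ((Real.pi / 4 : ℝ) * Complex.I) := by
    rw [omega]; push_cast; ring_nf
  rw [h, Complex.norm_exp_ofReal_mul_I]

theorem omega_ne_zero : omega ≠ 0 := by
  rw [← norm_ne_zero_iff, norm_omega]; norm_num

theorem I_mul_omega : Complex.I * omega = -starRingEnd ℂ omega := by
  rw [omega_eq]
  apply Complex.ext <;> simp

/-- The integrand of `riemannAux` has denominator `2i sin(πx)`. -/
theorem auxIntegrand_eq (s x : ℂ) :
    auxIntegrand s x = x ^ (-s) * Complex.exp (Real.pi * Complex.I * x ^ 2) /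
      (2 * Complex.I * Complex.sin (Real.pi * x)) := by
  have : Complex.exp (Real.pi * Complex.I * x) - Complex.exp (-(Real.pi * Complex.I * x)) =
      2 * Complex.I * Complex.sin (Real.pi * x) := by
    rw [Complex.sin, show -(Real.pi * x : ℂ) * Complex.I = -(Real.pi * Complex.I * x) by ring,
      show (Real.pi * x : ℂ) * Complex.I = Real.pi * Complex.I * x by ring]
    linear_combination (-(Complex.exp (-(Real.pi * Complex.I * x)) -
      Complex.exp (Real.pi * Complex.I * x))) * Complex.I_sq
  rw [auxIntegrand, this]

/-! ### Sine and integrand in the strip -/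

theorem norm_sq_sin (z : ℂ) :
    ‖Complex.sin z‖ ^ 2 = Real.sin z.re ^ 2 + Real.sinh z.im ^ 2 := by
  have h : Complex.sin z = ⟨Real.sin z.re * Real.cosh z.im, Real.cos z.re * Real.sinh z.im⟩ := by
    rw [Complex.sin_eq, ← Complex.ofReal_sin, ← Complex.ofReal_cos, ← Complex.ofReal_sinh,
      ← Complex.ofReal_cosh, ← Complex.ofReal_mul, ← Complex.ofReal_mul]
    apply Complex.ext <;> simp only [Complex.add_re, Complex.add_im, Complex.re_ofReal_mul,
      Complex.im_ofReal_mul, Complex.ofReal_re, Complex.ofReal_im, Complex.I_re, Complex.I_im] <;> ring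
  rw [h, ← Complex.normSq_eq_norm_sq, Complex.normSq_mk]
  linear_combination (Real.sin z.re ^ 2) * Real.cosh_sq z.im +
    (Real.sinh z.im ^ 2) * Real.cos_sq' z.re

theorem abs_le_abs_sinh (y : ℝ) : |y| ≤ |Real.sinh y| := by
  rcases le_total 0 y with h | h
  · rw [abs_of_nonneg h]
    exact (Real.self_le_sinh_iff.2 h).trans (le_abs_self _)
  · rw [abs_of_nonpos h]
    exact (neg_le_neg (Real.sinh_le_self_iff.2 h)).trans (neg_le_abs _)

/-- Jordan's inequality at πu for u ≤ 1/2 and at π(1 - u) beyond, where 2(1 - u) ≥ 1 - c ≥ (1 - c)u.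
-/
theorem le_sin_pi_mul {u c : ℝ} (h0 : 0 ≤ u) (hc : 0 ≤ c) (hu : u ≤ (1 + c) / 2) (hc1 : c < 1) :
    (1 - c) * u ≤ Real.sin (Real.pi * u) := by
  have hpi := Real.pi_pos
  rcases le_total u (1 / 2) with h | h
  · have := Real.mul_le_sin (x := Real.pi * u) (by positivity) (by nlinarith)
    rw [← mul_assoc, div_mul_cancel₀ _ hpi.ne'] at this
    nlinarith
  · have := Real.mul_le_sin (x := Real.pi * (1 - u)) (by nlinarith) (by nlinarith)
    rw [← mul_assoc, div_mul_cancel₀ _ hpi.ne', show Real.pi * (1 - u) = Real.pi - Real.pi * u by ring,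
      Real.sin_pi_sub] at this
    nlinarith

/-- Lower bound for the sine in the strip between the lines of slope `1` through `0` and `c`. -/
theorem le_norm_sin_of_strip {c : ℝ} (hc : 0 ≤ c) (hc1 : c < 1) {x : ℂ}
    (h0 : 0 ≤ x.re - x.im) (h1 : x.re - x.im ≤ c) :
    (1 - c) / 2 * ‖x‖ ≤ ‖Complex.sin (Real.pi * x)‖ := by
  have hre : |Real.sin (Real.pi * x.re)| ≤ ‖Complex.sin (Real.pi * x)‖ := by
    rw [← abs_of_nonneg (norm_nonneg (Complex.sin _)), ← sq_le_sq, norm_sq_sin]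
    simp [sq_nonneg]
  have him : Real.pi * |x.im| ≤ ‖Complex.sin (Real.pi * x)‖ := by
    have : |Real.sinh (Real.pi * x.im)| ≤ ‖Complex.sin (Real.pi * x)‖ := by
      rw [← abs_of_nonneg (norm_nonneg (Complex.sin _)), ← sq_le_sq, norm_sq_sin]
      simp [sq_nonneg]
    have h := abs_le_abs_sinh (Real.pi * x.im)
    rw [abs_mul, abs_of_pos Real.pi_pos] at h
    exact h.trans this
  have hx := Complex.norm_le_abs_re_add_abs_im x
  have hpi := Real.pi_gt_three
  have hx' : (1 - c) / 2 * ‖x‖ ≤ (1 - c) / 2 * (|x.re| + |x.im|) :=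
    mul_le_mul_of_nonneg_left hx (by linarith)
  refine hx'.trans ?_
  have hv := abs_nonneg x.im
  have him' : 3 * |x.im| ≤ ‖Complex.sin (Real.pi * x)‖ := by nlinarith
  -- For Re x ≤ 0 the strip forces |Re x| ≤ |Im x|, so the sinh bound suffices. Up to (1 + c)/2, the
  -- midpoint of c and 1, the real sine controls Re x. Beyond it Im x ≥ Re x - c ≥ (1 - c)/2, and
  -- sinh suffices again.
  rcases le_total x.re 0 with hu | hu
  · have : |x.re| ≤ |x.im| := by
      rw [abs_of_nonpos hu, abs_of_nonpos (by linarith)]; linarith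
    nlinarith
  rcases le_total x.re ((1 + c) / 2) with hu' | hu'
  · have := (le_sin_pi_mul hu hc hu' hc1).trans ((le_abs_self _).trans hre)
    rw [abs_of_nonneg hu]
    nlinarith
  · rw [abs_of_nonneg hu]
    rw [abs_of_nonneg (by linarith)] at him' ⊢
    nlinarith

theorem sin_pi_mul_ne_zero_of_strip {c : ℝ} (hc : 0 ≤ c) (hc1 : c < 1) {x : ℂ} (hx : x ≠ 0)
    (h0 : 0 ≤ x.re - x.im) (h1 : x.re - x.im ≤ c) : Complex.sin (Real.pi * x) ≠ 0 := by
  have := le_norm_sin_of_strip hc hc1 h0 h1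
  rw [← norm_pos_iff]
  have h2 : 0 < ‖x‖ := norm_pos_iff.2 hx
  exact lt_of_lt_of_le (mul_pos (by linarith) h2) this

theorem differentiableAt_auxIntegrand (s : ℂ) {x : ℂ} (hx : x ∈ Complex.slitPlane)
    (h : Complex.sin (Real.pi * x) ≠ 0) : DifferentiableAt ℂ (auxIntegrand s) x := by
  rw [funext (auxIntegrand_eq s)]
  refine DifferentiableAt.div (.mul (.cpow_const differentiableAt_id hx) (by fun_prop))
    (by fun_prop) ?_
  simp [h]

theorem measurable_auxIntegrand (s : ℂ) : Measurable (auxIntegrand s) := by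
  unfold auxIntegrand
  fun_prop

/-- The zero of the sine at 0 costs one power of |x|, and |arg x| ≤ π costs the factor e^{π|Im s|}.
-/
theorem norm_auxIntegrand_le {c : ℝ} (hc : 0 ≤ c) (hc1 : c < 1) (s : ℂ) {x : ℂ} (hx : x ≠ 0)
    (h0 : 0 ≤ x.re - x.im) (h1 : x.re - x.im ≤ c) :
    ‖auxIntegrand s x‖ ≤ Real.exp (Real.pi * |s.im|) / (1 - c) *
      (‖x‖ ^ (-s.re - 1) * Real.exp (-(2 * Real.pi * x.re * x.im))) := by
  have hx0 : 0 < ‖x‖ := norm_pos_iff.2 hx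
  have hsin := le_norm_sin_of_strip hc hc1 h0 h1
  have hcpow : ‖x ^ (-s)‖ ≤ ‖x‖ ^ (-s.re) * Real.exp (Real.pi * |s.im|) := by
    rw [Complex.norm_cpow_of_ne_zero hx, div_eq_mul_inv, ← Real.exp_neg, Complex.neg_re]
    gcongr
    rw [Complex.neg_im, mul_neg, neg_neg]
    refine (le_abs_self _).trans ?_
    rw [abs_mul]
    gcongr
    exact Complex.abs_arg_le_pi x
  have hexp : ‖Complex.exp (Real.pi * Complex.I * x ^ 2)‖ =
      Real.exp (-(2 * Real.pi * x.re * x.im)) := by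
    rw [Complex.norm_exp]
    congr 1
    simp [pow_two]; ring
  rw [auxIntegrand_eq, norm_div, norm_mul, hexp]
  have h1c : 0 < 1 - c := by linarith
  calc _ ≤ ‖x‖ ^ (-s.re) * Real.exp (Real.pi * |s.im|) * Real.exp (-(2 * Real.pi * x.re * x.im)) /
        ((1 - c) * ‖x‖) := by
        gcongr
        simp
        linarith
    _ = _ := by
        rw [Real.rpow_sub_one hx0.ne']
        field_simp

/-! ### Rotated coordinates -/

theorem omega_mul_re (t v : ℝ) : (omega * (t + v * Complex.I)).re = √2 / 2 * (t - v) := by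
  rw [omega_eq]; simp; ring

theorem omega_mul_im (t v : ℝ) : (omega * (t + v * Complex.I)).im = √2 / 2 * (t + v) := by
  rw [omega_eq]; simp; ring

theorem omega_mul_re_sub_im (t v : ℝ) :
    (omega * (t + v * Complex.I)).re - (omega * (t + v * Complex.I)).im = -(√2 * v) := by
  rw [omega_mul_re, omega_mul_im]; ring

theorem omega_mul_ne_zero {t v : ℝ} (h : t ≠ 0 ∨ v ≠ 0) : omega * (t + v * Complex.I) ≠ 0 := by
  refine mul_ne_zero omega_ne_zero fun h0 => ?_
  rcases h with h | h
  · exact h (by simpa using congrArg Complex.re h0)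
  · exact h (by simpa using congrArg Complex.im h0)

/-- For v ≤ 0 one has Re x ≥ Im x, so real points of this half-plane are nonnegative and the branch
cut is met only at 0. -/
theorem omega_mul_mem_slitPlane {t v : ℝ} (h : t ≠ 0 ∨ v ≠ 0) (hv : v ≤ 0) :
    omega * (t + v * Complex.I) ∈ Complex.slitPlane := by
  have h2 : 0 < √2 / 2 := by positivity
  rw [Complex.mem_slitPlane_iff, omega_mul_re, omega_mul_im]
  by_cases h0 : t + v = 0
  · left
    have : v ≠ 0 := fun hv0 => by
      rw [hv0, add_zero] at h0
      rcases h with h | h <;> contradiction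
    have : v < 0 := lt_of_le_of_ne hv this
    exact mul_pos h2 (by linarith)
  · exact Or.inr (mul_ne_zero h2.ne' h0)

/-! ### Uniform majorant -/

/-- A Gaussian majorant, uniform over horizontal lines, of the rotated integrand. -/
noncomputable def stripBound (p t : ℝ) : ℝ := (|t| ^ p + 1) * Real.exp (-Real.pi * t ^ 2)

theorem integrable_abs_rpow_mul_exp {p : ℝ} (hp : -1 < p) :
    MeasureTheory.Integrable fun t : ℝ => |t| ^ p * Real.exp (-Real.pi * t ^ 2) := by
  have h := integrable_rpow_mul_exp_neg_mul_sq Real.pi_pos hp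
  refine (h.norm.add h.comp_neg.norm).mono' (by fun_prop) (.of_forall fun t => ?_)
  simp only [Pi.add_apply, norm_mul, Real.norm_eq_abs, Real.abs_exp, neg_sq, ← add_mul]
  gcongr
  rw [abs_of_nonneg (by positivity : 0 ≤ |t| ^ p)]
  rcases le_total 0 t with ht | ht
  · rw [abs_of_nonneg ht]
    exact (le_abs_self _).trans (le_add_of_nonneg_right (abs_nonneg _))
  · rw [abs_of_nonpos ht]
    exact (le_abs_self _).trans (le_add_of_nonneg_left (abs_nonneg _))

theorem integrable_stripBound {p : ℝ} (hp : -1 < p) : MeasureTheory.Integrable (stripBound p) := by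
  have := (integrable_abs_rpow_mul_exp hp).add (integrable_exp_neg_mul_sq Real.pi_pos)
  refine this.congr (.of_forall fun t => ?_)
  simp only [stripBound, Pi.add_apply]
  ring

theorem tendsto_stripBound (p : ℝ) :
    Filter.Tendsto (stripBound p) (Filter.cocompact ℝ) (nhds 0) := by
  have := (tendsto_rpow_abs_mul_exp_neg_mul_sq_cocompact Real.pi_pos p).add
    (tendsto_rpow_abs_mul_exp_neg_mul_sq_cocompact Real.pi_pos 0)
  rw [add_zero] at this
  refine this.congr fun t => ?_
  simp only [stripBound, Real.rpow_zero]
  ring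

/-- For p ≤ 0 the power decreases; for p ≥ 0 use r ≤ 2 max(a, 1). The summand 1 is needed for p > 0,
when a^p can be small while r is not. -/
theorem rpow_le_of_near {a r p : ℝ} (ha : 0 < a) (har : a ≤ r) (hr : r ≤ a + 1) :
    r ^ p ≤ 2 ^ |p| * (a ^ p + 1) := by
  have h1 : (1 : ℝ) ≤ 2 ^ |p| := Real.one_le_rpow (by norm_num) (abs_nonneg p)
  have hap : 0 < a ^ p := Real.rpow_pos_of_pos ha p
  rcases le_total p 0 with hp | hp
  · have := Real.rpow_le_rpow_of_nonpos ha har hp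
    nlinarith
  · rw [abs_of_nonneg hp] at h1 ⊢
    rcases le_total a 1 with h | h
    · have : r ^ p ≤ 2 ^ p := Real.rpow_le_rpow (by linarith) (by linarith) hp
      nlinarith
    · have : r ^ p ≤ (2 * a) ^ p := Real.rpow_le_rpow (by linarith) (by linarith) hp
      rw [Real.mul_rpow (by norm_num) ha.le] at this
      nlinarith

/-- The constant in front of the majorant `stripBound`. -/
noncomputable def stripConst (c : ℝ) (s : ℂ) : ℝ :=
  Real.exp (Real.pi * |s.im|) / (1 - c) * (2 ^ |-s.re - 1| * Real.exp Real.pi)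

theorem norm_auxIntegrand_omega_mul_le {c : ℝ} (hc : 0 ≤ c) (hc1 : c < 1) (s : ℂ) {t v : ℝ}
    (ht : t ≠ 0) (hv : v ≤ 0) (hcv : -c ≤ √2 * v) :
    ‖auxIntegrand s (omega * (t + v * Complex.I))‖ ≤
      stripConst c s * stripBound (-s.re - 1) t := by
  have hd := omega_mul_re_sub_im t v
  have h2 : √2 * √2 = 2 := Real.mul_self_sqrt (by norm_num)
  have h2' : 1 ≤ √2 := Real.one_le_sqrt.2 (by norm_num)
  -- |v| ≤ 1 serves twice: |t| ≤ |t + iv| ≤ |t| + 1, as `rpow_le_of_near` requires, and e^{πv²} ≤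
  -- e^π.
  have hv1 : -1 ≤ v := by nlinarith
  have hx := omega_mul_ne_zero (v := v) (Or.inl ht)
  refine (norm_auxIntegrand_le hc hc1 s hx (by nlinarith) (by linarith)).trans ?_
  have hre : -(2 * Real.pi * (omega * (t + v * Complex.I)).re * (omega * (t + v * Complex.I)).im) =
      Real.pi * v ^ 2 + -Real.pi * t ^ 2 := by
    rw [omega_mul_re, omega_mul_im]
    linear_combination (-Real.pi * (t ^ 2 - v ^ 2) / 2) * h2
  have hn : ‖omega * (t + v * Complex.I)‖ = ‖(t + v * Complex.I : ℂ)‖ := by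
    rw [norm_mul, norm_omega, one_mul]
  have hlow : |t| ≤ ‖(t + v * Complex.I : ℂ)‖ := by
    simpa using Complex.abs_re_le_norm (t + v * Complex.I : ℂ)
  have hup : ‖(t + v * Complex.I : ℂ)‖ ≤ |t| + 1 := by
    refine (norm_add_le _ _).trans ?_
    simp only [Complex.norm_real, norm_mul, Complex.norm_I, mul_one, Real.norm_eq_abs]
    gcongr
    rw [abs_of_nonpos hv]; linarith
  have hpow := rpow_le_of_near (p := -s.re - 1) (abs_pos.2 ht) hlow hup
  rw [hre, hn, Real.exp_add, stripConst, stripBound]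
  have h1c : 0 < 1 - c := by linarith
  have hexp : Real.exp (Real.pi * v ^ 2) ≤ Real.exp Real.pi := by
    refine Real.exp_le_exp.2 (mul_le_of_le_one_right Real.pi_pos.le ?_)
    nlinarith
  calc _ ≤ Real.exp (Real.pi * |s.im|) / (1 - c) *
        (2 ^ |-s.re - 1| * (|t| ^ (-s.re - 1) + 1) *
          (Real.exp Real.pi * Real.exp (-Real.pi * t ^ 2))) := by gcongr
    _ = _ := by ring

theorem aestronglyMeasurable_auxIntegrand_omega_mul (s : ℂ) (v : ℝ) :
    MeasureTheory.AEStronglyMeasurable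
      (fun t : ℝ => auxIntegrand s (omega * (t + v * Complex.I))) :=
  ((measurable_auxIntegrand s).comp (by fun_prop)).aestronglyMeasurable

theorem ae_norm_auxIntegrand_omega_mul_le {c : ℝ} (hc : 0 ≤ c) (hc1 : c < 1) (s : ℂ) {v : ℝ}
    (hv : v ≤ 0) (hcv : -c ≤ √2 * v) :
    ∀ᵐ t : ℝ, ‖auxIntegrand s (omega * (t + v * Complex.I))‖ ≤
      stripConst c s * stripBound (-s.re - 1) t := by
  filter_upwards [MeasureTheory.Measure.ae_ne MeasureTheory.volume (0 : ℝ)] with t ht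
  exact norm_auxIntegrand_omega_mul_le hc hc1 s ht hv hcv

theorem integrable_auxIntegrand_omega_mul {c : ℝ} (hc : 0 ≤ c) (hc1 : c < 1) {s : ℂ}
    (hs : s.re < 0) {v : ℝ} (hv : v ≤ 0) (hcv : -c ≤ √2 * v) :
    MeasureTheory.Integrable (fun t : ℝ => auxIntegrand s (omega * (t + v * Complex.I))) :=
  ((integrable_stripBound (by linarith)).const_mul _).mono'
    (aestronglyMeasurable_auxIntegrand_omega_mul s v)
    (ae_norm_auxIntegrand_omega_mul_le hc hc1 s hv hcv)

theorem differentiableAt_auxIntegrand_omega_mul {c : ℝ} (hc : 0 ≤ c) (hc1 : c < 1) (s : ℂ)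
    {t v : ℝ} (h : t ≠ 0 ∨ v ≠ 0) (hv : v ≤ 0) (hcv : -c ≤ √2 * v) :
    DifferentiableAt ℂ (fun w : ℂ => auxIntegrand s (omega * w)) (t + v * Complex.I) := by
  have hd := omega_mul_re_sub_im t v
  have h2 : 0 ≤ √2 := Real.sqrt_nonneg 2
  refine DifferentiableAt.comp (g := auxIntegrand s) _ (differentiableAt_auxIntegrand s
    (omega_mul_mem_slitPlane h hv)
    (sin_pi_mul_ne_zero_of_strip hc hc1 (omega_mul_ne_zero h) (by nlinarith) (by linarith)))
    (by fun_prop)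

/-! ### Moving the line of integration -/

/-- Horizontal lines below the real axis, and above the first pole, may be moved. -/
theorem integral_auxIntegrand_shift {c : ℝ} (hc : 0 ≤ c) (hc1 : c < 1) {s : ℂ}
    (hs : s.re < 0) {v w : ℝ} (hv : v < 0) (hcv : -c ≤ √2 * v) (hw : w < 0)
    (hcw : -c ≤ √2 * w) :
    ∫ t : ℝ, auxIntegrand s (omega * (t + v * Complex.I)) =
      ∫ t : ℝ, auxIntegrand s (omega * (t + w * Complex.I)) := by
  set f : ℂ → ℂ := fun x => auxIntegrand s (omega * x) with hf
  have h2 : 0 < √2 := by positivity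
  have hmem : ∀ y ∈ Set.uIcc v w, y < 0 ∧ -c ≤ √2 * y := by
    intro y hy
    rw [Set.mem_uIcc] at hy
    rcases hy with hy | hy
    · exact ⟨by linarith, hcv.trans (by gcongr; exact hy.1)⟩
    · exact ⟨by linarith, hcw.trans (by gcongr; exact hy.1)⟩
  -- Cauchy's theorem on a rectangle; both heights are negative, so it stays away from the
  -- singularity at 0.
  have hrect : ∀ T : ℝ, (∫ x : ℝ in (-T)..T, f (x + v * Complex.I)) -
      (∫ x : ℝ in (-T)..T, f (x + w * Complex.I)) =
      Complex.I • (∫ y : ℝ in v..w, f ((-T : ℝ) + y * Complex.I)) -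
      Complex.I • (∫ y : ℝ in v..w, f ((T : ℝ) + y * Complex.I)) := by
    intro T
    have := Complex.integral_boundary_rect_eq_zero_of_differentiableOn f ⟨-T, v⟩ ⟨T, w⟩ ?_
    · simp only at this
      linear_combination this
    · intro x hx
      rw [Complex.mem_reProdIm] at hx
      have hy := hmem _ hx.2
      have := differentiableAt_auxIntegrand_omega_mul (t := x.re) hc hc1 s (Or.inr hy.1.ne)
        hy.1.le hy.2
      rw [Complex.re_add_im] at this
      exact this.differentiableWithinAt
  have hvert : ∀ T : ℝ, T ≠ 0 → ‖∫ y : ℝ in v..w, f ((T : ℝ) + y * Complex.I)‖ ≤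
      stripConst c s * stripBound (-s.re - 1) T * |w - v| := by
    intro T hT
    refine intervalIntegral.norm_integral_le_of_norm_le_const fun y hy => ?_
    have hy := hmem y (Set.uIoc_subset_uIcc hy)
    exact norm_auxIntegrand_omega_mul_le hc hc1 s hT hy.1.le hy.2
  -- The cocompact filter covers the vertical sides at T and at -T together.
  have hvert0 : Filter.Tendsto (fun T : ℝ => ∫ y : ℝ in v..w, f ((T : ℝ) + y * Complex.I))
      (Filter.cocompact ℝ) (nhds 0) := by
    have hb := ((tendsto_stripBound (-s.re - 1)).const_mul (stripConst c s)).mul_const |w - v|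
    rw [mul_zero, zero_mul] at hb
    refine squeeze_zero_norm' ?_ hb
    filter_upwards [(isCompact_singleton (x := (0 : ℝ))).compl_mem_cocompact] with T hT
    exact hvert T hT
  have htop := hvert0.mono_left atTop_le_cocompact
  have hbot := (hvert0.mono_left atBot_le_cocompact).comp Filter.tendsto_neg_atTop_atBot
  have hlim := (hbot.const_smul Complex.I).sub (htop.const_smul Complex.I)
  simp only [smul_zero, sub_zero, Function.comp_def] at hlim
  have hI : ∀ {u : ℝ}, u < 0 → -c ≤ √2 * u → Filter.Tendsto
      (fun T : ℝ => ∫ x : ℝ in (-T)..T, f (x + u * Complex.I)) Filter.atTop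
      (nhds (∫ x : ℝ, f (x + u * Complex.I))) := fun hu hcu =>
    MeasureTheory.intervalIntegral_tendsto_integral
      (integrable_auxIntegrand_omega_mul hc hc1 hs hu.le hcu)
      Filter.tendsto_neg_atTop_atBot Filter.tendsto_id
  have hlim' := (hI hv hcv).sub (hI hw hcw)
  simp only [hrect] at hlim'
  exact sub_eq_zero.1 (tendsto_nhds_unique hlim' hlim)

/-- The line of integration may be moved onto the branch point and pole at the origin. -/
theorem integral_auxIntegrand_shift_zero {c : ℝ} (hc : 0 < c) (hc1 : c < 1) {s : ℂ}
    (hs : s.re < 0) {v : ℝ} (hv : v < 0) (hcv : -c ≤ √2 * v) :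
    ∫ t : ℝ, auxIntegrand s (omega * (t + v * Complex.I)) =
      ∫ t : ℝ, auxIntegrand s (omega * t) := by
  have h2 : 0 < √2 := by positivity
  have hev : ∀ᶠ w : ℝ in nhdsWithin 0 (Set.Iio 0), w < 0 ∧ -c ≤ √2 * w := by
    filter_upwards [self_mem_nhdsWithin, Ioo_mem_nhdsLT hv] with w hw hw'
    exact ⟨hw, hcv.trans (by gcongr; exact hw'.1.le)⟩
  have hlim : Filter.Tendsto
      (fun w : ℝ => ∫ t : ℝ, auxIntegrand s (omega * (t + w * Complex.I)))
      (nhdsWithin 0 (Set.Iio 0)) (nhds (∫ t : ℝ, auxIntegrand s (omega * t))) := by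
    -- The majorant does not depend on w, and its singularity at t = 0 is integrable because -Re s -
    -- 1 > -1.
    refine MeasureTheory.tendsto_integral_filter_of_dominated_convergence
      (fun t => stripConst c s * stripBound (-s.re - 1) t)
      (.of_forall fun w => aestronglyMeasurable_auxIntegrand_omega_mul s w) ?_
      ((integrable_stripBound (by linarith)).const_mul _) ?_
    · filter_upwards [hev] with w hw
      exact ae_norm_auxIntegrand_omega_mul_le hc.le hc1 s hw.1.le hw.2
    · filter_upwards [MeasureTheory.Measure.ae_ne MeasureTheory.volume (0 : ℝ)] with t ht
      have hcont := (differentiableAt_auxIntegrand_omega_mul (v := 0) hc.le hc1 s (Or.inl ht) le_rfl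
        (by simpa using hc.le)).continuousAt
      have hpath : Filter.Tendsto (fun w : ℝ => (t + w * Complex.I : ℂ))
          (nhdsWithin 0 (Set.Iio 0)) (nhds (t + (0 : ℝ) * Complex.I)) :=
        (Continuous.tendsto (by fun_prop) _).mono_left nhdsWithin_le_nhds
      simpa [Function.comp_def] using hcont.tendsto.comp hpath
  refine tendsto_nhds_unique (tendsto_const_nhds.congr' ?_) hlim
  filter_upwards [hev] with w hw
  exact integral_auxIntegrand_shift hc.le hc1 hs hv hcv hw.1 hw.2

/-! ### The two half-lines from the origin -/

theorem ofReal_mul_exp_cpow {y θ : ℝ} (hy : 0 < y) (h1 : -Real.pi < θ) (h2 : θ ≤ Real.pi) (a : ℂ) :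
    ((y : ℂ) * Complex.exp (θ * Complex.I)) ^ a =
      (y : ℂ) ^ a * Complex.exp (θ * Complex.I * a) := by
  have hy0 : (y : ℂ) ≠ 0 := by exact_mod_cast hy.ne'
  rw [Complex.cpow_def_of_ne_zero (mul_ne_zero hy0 (Complex.exp_ne_zero _)),
    Complex.cpow_def_of_ne_zero hy0, Complex.log_ofReal_mul hy (Complex.exp_ne_zero _),
    Complex.log_exp (by simpa using h1) (by simpa using h2), ← Complex.exp_add,
    Complex.ofReal_log hy.le, add_mul]

theorem auxIntegrand_omega_mul (s : ℂ) {y : ℝ} (hy : 0 < y) :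
    auxIntegrand s (omega * y) = Complex.exp (-(Real.pi * Complex.I * s / 4)) / (2 * Complex.I) *
      ((y : ℂ) ^ (-s) * Complex.exp (-(Real.pi * (y : ℂ) ^ 2)) /
        Complex.sin (Real.pi * omega * y)) := by
  have hpi := Real.pi_pos
  have hpow : (omega * y) ^ (-s) =
      (y : ℂ) ^ (-s) * Complex.exp (-(Real.pi * Complex.I * s / 4)) := by
    have : omega * y = y * Complex.exp ((Real.pi / 4 : ℝ) * Complex.I) := by
      rw [omega]; push_cast; ring_nf
    rw [this, ofReal_mul_exp_cpow hy (by linarith) (by linarith)]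
    push_cast; ring_nf
  have hexp : (Real.pi * Complex.I * (omega * y) ^ 2 : ℂ) = -(Real.pi * (y : ℂ) ^ 2) := by
    rw [mul_pow, omega_sq]
    linear_combination (Real.pi * (y : ℂ) ^ 2) * Complex.I_sq
  rw [auxIntegrand_eq, hpow, hexp, ← mul_assoc, div_mul_div_comm]
  ring

/-- The principal argument of -ωy is -3π/4, not 5π/4, whence e^{3πis/4}; the minus sign comes from
the odd sine. -/
theorem auxIntegrand_omega_mul_neg (s : ℂ) {y : ℝ} (hy : 0 < y) :
    auxIntegrand s (omega * (-y : ℝ)) =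
      -Complex.exp (3 * Real.pi * Complex.I * s / 4) / (2 * Complex.I) *
      ((y : ℂ) ^ (-s) * Complex.exp (-(Real.pi * (y : ℂ) ^ 2)) /
        Complex.sin (Real.pi * omega * y)) := by
  have hpi := Real.pi_pos
  have hpow : (omega * (-y : ℝ)) ^ (-s) =
      (y : ℂ) ^ (-s) * Complex.exp (3 * Real.pi * Complex.I * s / 4) := by
    have : omega * (-y : ℝ) = y * Complex.exp ((-(3 * Real.pi / 4) : ℝ) * Complex.I) := by
      have : ((-(3 * Real.pi / 4) : ℝ) * Complex.I : ℂ) =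
        Real.pi * Complex.I / 4 - Real.pi * Complex.I := by push_cast; ring
      rw [this, Complex.exp_sub, Complex.exp_pi_mul_I, omega]
      push_cast; ring
    rw [this, ofReal_mul_exp_cpow hy (by linarith) (by linarith)]
    push_cast; ring_nf
  have hexp : (Real.pi * Complex.I * (omega * (-y : ℝ)) ^ 2 : ℂ) = -(Real.pi * (y : ℂ) ^ 2) := by
    rw [mul_pow, omega_sq]
    push_cast
    linear_combination (Real.pi * (y : ℂ) ^ 2) * Complex.I_sq
  have hsin : Complex.sin (Real.pi * (omega * (-y : ℝ))) = -Complex.sin (Real.pi * omega * y) := by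
    rw [← Complex.sin_neg]
    push_cast; ring_nf
  rw [auxIntegrand_eq, hpow, hexp, hsin, mul_neg, div_neg, neg_div, neg_mul, div_mul_div_comm]
  ring

/-- With a = πω̄y, cancel e^a; since iω = -ω̄, what remains below is e^{-a} - e^a = 2i sin(πωy).
This makes the two closed forms equivalent. -/
theorem exp_div_one_sub_exp_eq (y : ℝ) :
    Complex.exp (-(Real.pi * (y : ℂ) ^ 2) + Real.pi * starRingEnd ℂ omega * y) /
      (1 - Complex.exp (2 * Real.pi * starRingEnd ℂ omega * y)) =
    1 / (2 * Complex.I) *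
      (Complex.exp (-(Real.pi * (y : ℂ) ^ 2)) / Complex.sin (Real.pi * omega * y)) := by
  set a : ℂ := Real.pi * starRingEnd ℂ omega * y with ha
  have hsin : 2 * Complex.I * Complex.sin (Real.pi * omega * y) =
      Complex.exp (-a) - Complex.exp a := by
    have : (Real.pi * omega * y : ℂ) * Complex.I = -a := by
      rw [ha]; linear_combination (Real.pi * y : ℂ) * I_mul_omega
    rw [Complex.sin, neg_mul, this, neg_neg]
    linear_combination (Complex.exp a - Complex.exp (-a)) * Complex.I_sq
  have h1 : 1 - Complex.exp (2 * Real.pi * starRingEnd ℂ omega * y) =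
      Complex.exp a * (Complex.exp (-a) - Complex.exp a) := by
    rw [mul_sub, ← Complex.exp_add, ← Complex.exp_add, add_neg_cancel, Complex.exp_zero, ha]
    ring_nf
  rw [h1, ← hsin, Complex.exp_add, mul_comm (Complex.exp a),
    mul_div_mul_right _ _ (Complex.exp_ne_zero a), div_mul_div_comm, one_mul]

/-! ### The original path and the closed forms -/

/-- Since ωω̄ = 1, c = ω·cω̄ with ω̄ = (1 - i)/√2, so the path has height -c/√2. -/
theorem auxPath_eq (c t : ℝ) :
    auxPath c t =
      omega * (((c * (√2 / 2) - t : ℝ) : ℂ) + ((-(c * (√2 / 2)) : ℝ) : ℂ) * Complex.I) := by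
  have h2 : √2 * √2 = 2 := Real.mul_self_sqrt (by norm_num)
  rw [auxPath, omega_eq]
  apply Complex.ext
  · simp; linear_combination (-c / 2) * h2
  · simp; ring

theorem integrable_and_integral_auxPath {c : ℝ} (hc : 0 < c) (hc1 : c < 1) {s : ℂ}
    (hs : s.re < 0) :
    MeasureTheory.Integrable (fun t : ℝ => auxIntegrand s (auxPath c t)) ∧
      ∫ t : ℝ, auxIntegrand s (auxPath c t) = ∫ t : ℝ, auxIntegrand s (omega * t) := by
  have h2 : √2 * √2 = 2 := Real.mul_self_sqrt (by norm_num)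
  have hv : -(c * (√2 / 2)) < 0 := by
    have : 0 < √2 := by positivity
    have := mul_pos hc this
    linarith
  have hcv : -c ≤ √2 * -(c * (√2 / 2)) := le_of_eq (by linear_combination (c / 2) * h2)
  simp only [auxPath_eq]
  -- The reflection t ↦ c/√2 - t preserves Lebesgue measure; the orientation is carried by the
  -- factor -ω of `riemannAux`.
  refine ⟨(integrable_auxIntegrand_omega_mul hc.le hc1 hs hv.le hcv).comp_sub_left _, ?_⟩
  rw [← integral_auxIntegrand_shift_zero hc hc1 hs hv hcv]
  exact MeasureTheory.integral_sub_left_eq_self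
    (fun t : ℝ => auxIntegrand s (omega * (t + ((-(c * (√2 / 2)) : ℝ) : ℂ) * Complex.I))) _ _

theorem integrableOn_div_sin {s : ℂ} (hs : s.re < 0) :
    MeasureTheory.IntegrableOn
      (fun y : ℝ => (y : ℂ) ^ (-s) * Complex.exp (-(Real.pi * (y : ℂ) ^ 2)) /
        Complex.sin (Real.pi * omega * y)) (Set.Ioi 0) := by
  -- Here c = 0: the strip degenerates to the line through the origin.
  have h := integrable_auxIntegrand_omega_mul le_rfl one_pos hs (v := 0) le_rfl (by simp)
  refine MeasureTheory.IntegrableOn.congr_fun ((h.integrableOn (s := Set.Ioi 0)).const_mul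
    (2 * Complex.I * Complex.exp (Real.pi * Complex.I * s / 4))) (fun y hy => ?_)
    measurableSet_Ioi
  simp only [Complex.ofReal_zero, zero_mul, add_zero]
  rw [auxIntegrand_omega_mul s hy, ← mul_assoc, Complex.exp_neg, div_eq_mul_inv _ (2 * Complex.I)]
  have := Complex.exp_ne_zero (Real.pi * Complex.I * s / 4)
  have hI : (2 * Complex.I) ≠ 0 := by simp
  have : (2 * Complex.I * Complex.exp (Real.pi * Complex.I * s / 4)) *
      ((Complex.exp (Real.pi * Complex.I * s / 4))⁻¹ * (2 * Complex.I)⁻¹) = 1 := by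
    rw [← mul_inv_rev, mul_inv_cancel₀ (mul_ne_zero hI this)]
  rw [this, one_mul]

theorem integral_auxIntegrand_omega_mul {s : ℂ} (hs : s.re < 0) :
    ∫ t : ℝ, auxIntegrand s (omega * t) =
      (Complex.exp (-(Real.pi * Complex.I * s / 4)) - Complex.exp (3 * Real.pi * Complex.I * s / 4)) /
        (2 * Complex.I) *
      ∫ y in Set.Ioi (0 : ℝ), (y : ℂ) ^ (-s) * Complex.exp (-(Real.pi * (y : ℂ) ^ 2)) /
        Complex.sin (Real.pi * omega * y) := by
  have h := integrable_auxIntegrand_omega_mul le_rfl one_pos hs (v := 0) le_rfl (by simp)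
  simp only [Complex.ofReal_zero, zero_mul, add_zero] at h
  have hneg := integral_comp_neg_Ioi 0 (fun t : ℝ => auxIntegrand s (omega * t))
  rw [neg_zero] at hneg
  rw [← MeasureTheory.integral_add_compl measurableSet_Ioi h (s := Set.Ioi 0), Set.compl_Ioi,
    ← hneg,
    MeasureTheory.setIntegral_congr_fun measurableSet_Ioi (fun y hy => auxIntegrand_omega_mul s hy),
    MeasureTheory.setIntegral_congr_fun measurableSet_Ioi
      (fun y hy => auxIntegrand_omega_mul_neg s hy),
    MeasureTheory.integral_const_mul, MeasureTheory.integral_const_mul]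
  ring

theorem mainTheorem2 (c : ℝ) (hc0 : 0 < c) (hc1 : c < 1) (s : ℂ) (hs : s.re < 0) :
    MeasureTheory.Integrable (fun t : ℝ => auxIntegrand s (auxPath c t) * (-omega)) ∧
    MeasureTheory.IntegrableOn
      (fun y : ℝ => (y : ℂ) ^ (-s) *
        (Complex.exp (-(Real.pi * (y : ℂ) ^ 2) + Real.pi * starRingEnd ℂ omega * y) /
          (1 - Complex.exp (2 * Real.pi * starRingEnd ℂ omega * y))))
      (Set.Ioi 0) ∧
    MeasureTheory.IntegrableOn
      (fun y : ℝ => (y : ℂ) ^ (-s) * Complex.exp (-(Real.pi * (y : ℂ) ^ 2)) /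
        Complex.sin (Real.pi * omega * y))
      (Set.Ioi 0) ∧
    riemannAux c s =
      -omega * Complex.exp (-(Real.pi * Complex.I * s / 4)) *
        (1 - Complex.exp (Real.pi * Complex.I * s)) *
        ∫ y in Set.Ioi (0 : ℝ), (y : ℂ) ^ (-s) *
          (Complex.exp (-(Real.pi * (y : ℂ) ^ 2) + Real.pi * starRingEnd ℂ omega * y) /
            (1 - Complex.exp (2 * Real.pi * starRingEnd ℂ omega * y))) ∧
    riemannAux c s =
      omega * Complex.exp (Real.pi * Complex.I * s / 4) * Complex.sin (Real.pi * s / 2) *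
        ∫ y in Set.Ioi (0 : ℝ), (y : ℂ) ^ (-s) * Complex.exp (-(Real.pi * (y : ℂ) ^ 2)) /
          Complex.sin (Real.pi * omega * y) := by
  have hF : (fun y : ℝ => (y : ℂ) ^ (-s) *
      (Complex.exp (-(Real.pi * (y : ℂ) ^ 2) + Real.pi * starRingEnd ℂ omega * y) /
        (1 - Complex.exp (2 * Real.pi * starRingEnd ℂ omega * y)))) =
      fun y : ℝ => 1 / (2 * Complex.I) * ((y : ℂ) ^ (-s) *
        Complex.exp (-(Real.pi * (y : ℂ) ^ 2)) / Complex.sin (Real.pi * omega * y)) := by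
    funext y
    rw [exp_div_one_sub_exp_eq]
    ring
  have hG := integrableOn_div_sin hs
  obtain ⟨hint, hval⟩ := integrable_and_integral_auxPath hc0 hc1 hs
  have hR : riemannAux c s = -omega * (Complex.exp (-(Real.pi * Complex.I * s / 4)) -
      Complex.exp (3 * Real.pi * Complex.I * s / 4)) / (2 * Complex.I) *
      ∫ y in Set.Ioi (0 : ℝ), (y : ℂ) ^ (-s) * Complex.exp (-(Real.pi * (y : ℂ) ^ 2)) /
        Complex.sin (Real.pi * omega * y) := by
    rw [riemannAux, MeasureTheory.integral_mul_const, hval, integral_auxIntegrand_omega_mul hs]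
    ring
  have hexp : Complex.exp (-(Real.pi * Complex.I * s / 4)) -
      Complex.exp (3 * Real.pi * Complex.I * s / 4) =
      Complex.exp (-(Real.pi * Complex.I * s / 4)) * (1 - Complex.exp (Real.pi * Complex.I * s)) := by
    rw [mul_sub, mul_one, ← Complex.exp_add]
    ring_nf
  -- Factoring out e^{πis/4}, the exponential of the mean exponent, leaves e^{-πis/2} - e^{πis/2}.
  have hsin : Complex.exp (-(Real.pi * Complex.I * s / 4)) -
      Complex.exp (3 * Real.pi * Complex.I * s / 4) =
      -(2 * Complex.I) * (Complex.exp (Real.pi * Complex.I * s / 4) *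
        Complex.sin (Real.pi * s / 2)) := by
    have h1 : Complex.exp (-(Real.pi * Complex.I * s / 4)) =
        Complex.exp (Real.pi * Complex.I * s / 4) *
          Complex.exp (-(Real.pi * s / 2) * Complex.I) := by
      rw [← Complex.exp_add]; ring_nf
    have h2 : Complex.exp (3 * Real.pi * Complex.I * s / 4) =
        Complex.exp (Real.pi * Complex.I * s / 4) *
          Complex.exp (Real.pi * s / 2 * Complex.I) := by
      rw [← Complex.exp_add]; ring_nf
    rw [h1, h2, Complex.sin]
    linear_combination (Complex.exp (Real.pi * Complex.I * s / 4) *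
      (Complex.exp (-(Real.pi * s / 2) * Complex.I) -
        Complex.exp (Real.pi * s / 2 * Complex.I))) * Complex.I_sq
  refine ⟨hint.mul_const _, ?_, hG, ?_, ?_⟩
  · rw [hF]
    exact hG.const_mul _
  · rw [hF, MeasureTheory.integral_const_mul, hR, hexp]
    ring
  · have hI : (2 * Complex.I) ≠ 0 := by simp
    rw [hR, hsin, neg_mul, neg_mul, mul_neg, neg_neg, mul_left_comm, mul_div_cancel_left₀ _ hI]
    ring
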